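/- Let $X$ be a compact metric space with metric $d$ and $f\colon X\to X$ a continuous map. A Borel probability measure $\mu$ on $X$ is invariant if $\mu(f^{-1}(B))=\mu(B)$ for every Borel set $B$. A set $A\subset X$ is measure saturated if for every open $U$ with $U\cap A\neq\emptyset$ there is an invariant Borel probability measure $\mu$ with $\mu(U)>0$. The measure center $Y$ of $f$ is the largest measure saturated subset of $X$; it is closed and satisfies $f(Y)\subset Y$. A minimal set is a nonempty closed set $M\subset X$ with $f(M)\subset M$ that has no proper nonempty closed subset $M'$ with $f(M')\subset M'$; $M(f)$ denotes the set of minimal points, that is, of all elements of minimal sets. A mistake function is a function $g\colon\{0,1,2,\dots\}\times(0,\varepsilon_0]\to\{1,2,\dots\}$, for some $\varepsilon_0>0$, such that for every $\varepsilon\in(0,\varepsilon_0]$ we have $g(n,\varepsilon)\le g(n+1,\varepsilon)$ for all $n$ and $\lim_{n\to\infty}g(n,\varepsilon)/n=0$; for $\varepsilon>\varepsilon_0$ put $g(n,\varepsilon)=g(n,\varepsilon_0)$. When $g(n,\varepsilon)<n$, let $B_n(g;x,\varepsilon)$ be the set of all $y$ for which there is $A\subset\{0,\dots,n-1\}$ with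 $|A|\ge n-g(n,\varepsilon)$ and $d(f^i(x),f^i(y))<\varepsilon$ for all $i\in A$. The system $(X,f)$ has the almost specification property if there are a mistake function $g$ and a function $k_g\colon(0,\infty)\to\{1,2,\dots\}$, with $g(n,\varepsilon)<n$ whenever $n\ge k_g(\varepsilon)$, such that for all $m\ge1$, $\varepsilon_1,\dots,\varepsilon_m>0$, $x_1,\dots,x_m\in X$ and integers $n_1\ge k_g(\varepsilon_1),\dots,n_m\ge k_g(\varepsilon_m)$ there is a point $z\in X$ (a tracing point) such that, for every $j=1,\dots,m$, $$f^{l_j}(z)\in B_{n_j}(g;x_j,\varepsilon_j),\qquad\text{where } l_j=\sum_{s=1}^{j-1}n_s .$$ **Theorem.** $(X,f)$ has the almost specification property if and only if $(Y,f|_Y)$ has the almost specification property. Moreover, if $(X,f)$ has the almost specification property, then $g$ and $k_g$ can be chosen so that, for all $m$, $\varepsilon_j$, $x_j\in X$ and $n_j$ as above, the tracing point $z$ can be taken in $M(f)$. -/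

import Mathlib

open Set Filter Topology MeasureTheory

/-- A mistake function `g : ℤ₊ × (0, ε₀] → {1, 2, 3, …}`; only the values of `toFun n ε` with
`0 < ε ≤ ε₀` are meaningful, see `MistakeFunction.val`. -/
structure MistakeFunction where
  ε₀ : ℝ
  ε₀_pos : 0 < ε₀
  toFun : ℕ → ℝ → ℕ
  pos : ∀ n ε, 0 < ε → ε ≤ ε₀ → 0 < toFun n ε
  mono : ∀ n ε, 0 < ε → ε ≤ ε₀ → toFun n ε ≤ toFun (n + 1) ε
  tendsto : ∀ ε, 0 < ε → ε ≤ ε₀ →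
    Tendsto (fun n : ℕ => (toFun n ε : ℝ) / (n : ℝ)) atTop (𝓝 0)

/-- The value `g(n, ε)`, with the convention `g(n, ε) = g(n, ε₀)` for `ε > ε₀`. -/
noncomputable def MistakeFunction.val (g : MistakeFunction) (n : ℕ) (ε : ℝ) : ℕ :=
  g.toFun n (min ε g.ε₀)

/-- The family `I(g; n, ε)` of subsets of `{0, …, n - 1}` with at least `n - g(n, ε)` elements. -/
def almostFullSubsets (g : MistakeFunction) (n : ℕ) (ε : ℝ) : Set (Finset ℕ) :=
  {A | A ⊆ Finset.range n ∧ n ≤ A.card + g.val n ε}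

/-- The Bowen ball `B_A(x, ε)` of radius `ε` centered at `x` along `A`. -/
def bowenBallAlong {X : Type*} [MetricSpace X] (f : X → X) (A : Finset ℕ) (x : X) (ε : ℝ) :
    Set X :=
  {y | ∀ i ∈ A, dist (f^[i] x) (f^[i] y) < ε}

/-- The Bowen ball `B_n(g; x, ε)`, the union of the `B_A(x, ε)` over `A ∈ I(g; n, ε)`. -/
def mistakeBowenBall {X : Type*} [MetricSpace X] (f : X → X) (g : MistakeFunction)
    (n : ℕ) (x : X) (ε : ℝ) : Set X :=
  ⋃ A ∈ almostFullSubsets g n ε, bowenBallAlong f A x ε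

/-- Almost specification with mistake function `g`, length function `k`, and tracing points
taken in the set `Z`. The first part says that `k` takes positive values and that the Bowen
balls `B_n(g; x, ε)` with `n ≥ k(ε)` are well defined, i.e. that `g(n, ε) < n`. -/
def TracesIn {X : Type*} [MetricSpace X] (f : X → X) (g : MistakeFunction) (k : ℝ → ℕ)
    (Z : Set X) : Prop :=
  (∀ ε : ℝ, 0 < ε → 0 < k ε ∧ ∀ n : ℕ, k ε ≤ n → g.val n ε < n) ∧
  ∀ m : ℕ, 1 ≤ m → ∀ (ε : Fin m → ℝ) (x : Fin m → X) (n : Fin m → ℕ),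
    (∀ j, 0 < ε j) → (∀ j, k (ε j) ≤ n j) →
      ∃ z ∈ Z, ∀ j : Fin m,
        f^[∑ s ∈ Finset.Iio j, n s] z ∈ mistakeBowenBall f g (n j) (x j) (ε j)

/-- The almost specification property of `f : X → X`. -/
def HasAlmostSpecification {X : Type*} [MetricSpace X] (f : X → X) : Prop :=
  ∃ (g : MistakeFunction) (k : ℝ → ℕ), TracesIn f g k Set.univ

/-- Minimal sets: nonempty closed invariant sets without smaller nonempty closed
invariant subsets. -/
def IsMinimalSet {X : Type*} [MetricSpace X] (f : X → X) (M : Set X) : Prop :=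
  Minimal (fun A : Set X => IsClosed A ∧ A.Nonempty ∧ MapsTo f A A) M

/-- The set `M(f)` of minimal points. -/
def minimalPoints {X : Type*} [MetricSpace X] (f : X → X) : Set X :=
  {x | ∃ M : Set X, IsMinimalSet f M ∧ x ∈ M}

/-- Measure saturated sets. -/
def IsMeasureSaturated {X : Type*} [MetricSpace X] [MeasurableSpace X] (f : X → X)
    (A : Set X) : Prop :=
  ∀ U : Set X, IsOpen U → (U ∩ A).Nonempty →
    ∃ μ : Measure X, IsProbabilityMeasure μ ∧ MeasurePreserving f μ μ ∧ 0 < μ U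

/-- The measure center: the union of all measure saturated sets, which is the largest one
(`isGreatest_measureCenter`). -/
def measureCenter {X : Type*} [MetricSpace X] [MeasurableSpace X] (f : X → X) : Set X :=
  ⋃₀ {A | IsMeasureSaturated f A}

theorem isGreatest_measureCenter {X : Type*} [MetricSpace X] [MeasurableSpace X] (f : X → X) :
    IsGreatest {A | IsMeasureSaturated f A} (measureCenter f) := by
  refine ⟨?_, fun A hA => Set.subset_sUnion_of_mem hA⟩
  rintro U hU ⟨x, hxU, A, hA, hxA⟩
  exact hA U hU ⟨x, hxU, hxA⟩

theorem isClosed_measureCenter {X : Type*} [MetricSpace X] [MeasurableSpace X] (f : X → X) :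
    IsClosed (measureCenter f) := by
  refine isClosed_of_closure_subset ((isGreatest_measureCenter f).2 ?_)
  rintro U hU ⟨x, hxU, hx⟩
  exact (isGreatest_measureCenter f).1 U hU (mem_closure_iff.1 hx U hU hxU)

theorem mapsTo_measureCenter {X : Type*} [MetricSpace X] [MeasurableSpace X] [BorelSpace X]
    {f : X → X} (hf : Continuous f) : MapsTo f (measureCenter f) (measureCenter f) := by
  rw [mapsTo_iff_image_subset]
  refine (isGreatest_measureCenter f).2 ?_
  rintro U hU ⟨_, hxU, x, hx, rfl⟩
  obtain ⟨μ, hμ, hinv, hpos⟩ :=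
    (isGreatest_measureCenter f).1 (f ⁻¹' U) (hU.preimage hf) ⟨x, hxU, hx⟩
  refine ⟨μ, hμ, hinv, ?_⟩
  rwa [hinv.measure_preimage hU.measurableSet.nullMeasurableSet] at hpos

/-!
The measure center `Y` controls where orbits spend their time: for every open `U ⊇ Y` the
proportion of time spent outside `U` tends to `0` uniformly over all starting points
(`exists_forall_count_notMem_le`). Otherwise a weak limit of empirical measures of longer and
longer orbit segments would be an invariant probability measure charging the complement of `U`,
while the support of an invariant measure is contained in `Y`. It follows that every minimal set
meets `Y`, hence is contained in `Y` (`minimalPoints_subset_measureCenter`).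

If `f` has almost specification, repeat a given list of orbit segments periodically. Tracing points
of longer and longer repetitions accumulate on points tracing the periodic pattern forever; these
form a closed nonempty set invariant under `f^P`, where `P` is the period, so it contains a minimal
set of `f^P`, whose points are minimal for `f`. This gives tracing by minimal points
(`TracesIn.halfScale_minimalPoints`), and, as these lie in `Y`, almost specification of `f|_Y`
(`TracesIn.restrict`).

Conversely, let `f|_Y` have almost specification. Cut a long orbit segment into blocks of length
between `L` and `2 L`. A block starting close to `Y` follows the orbit of a point of `Y`, and
tracing that orbit costs few mistakes when `L` is large; the blocks starting away from `Y` are few,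
because each contributes at least one moment spent away from `Y`, and can be given up
(`exists_blocks_count_le`). Hence the minimal number of mistakes needed to trace segments of length
`n` this way is `o(n)` for every scale, and its running maximum is a mistake function for `f`
(`exists_mistakeFunction_ge`, `hasAlmostSpecification_of_restrict_measureCenter`).

Concatenation of segments is handled with lists (`Visits`), and mistakes are counted by `Nat.count`
(`mem_mistakeBowenBall_iff`).
-/

/-! ### Empirical measures and the measure center -/

/-- The empirical measure `(δ_x + δ_{f x} + ⋯ + δ_{f^{n-1} x}) / n` of an orbit segment. -/
noncomputable def empiricalMeasure {X : Type*} [MeasurableSpace X] (f : X → X) (n : ℕ) (x : X) :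
    Measure X :=
  (n : ENNReal)⁻¹ • ∑ i ∈ Finset.range n, Measure.dirac (f^[i] x)

open scoped Classical in
theorem empiricalMeasure_apply {X : Type*} [MeasurableSpace X] (f : X → X) (n : ℕ) (x : X)
    {F : Set X} (hF : MeasurableSet F) :
    empiricalMeasure f n x F = (n : ENNReal)⁻¹ * (Nat.count (fun i => f^[i] x ∈ F) n : ℕ) := by
  simp only [empiricalMeasure, Measure.smul_apply, Measure.finsetSum_apply, smul_eq_mul,
    Nat.count_eq_card_filter_range]
  congr 1
  simp [Measure.dirac_apply' _ hF, Set.indicator_apply]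

theorem isProbabilityMeasure_empiricalMeasure {X : Type*} [MeasurableSpace X] (f : X → X)
    {n : ℕ} (hn : n ≠ 0) (x : X) : IsProbabilityMeasure (empiricalMeasure f n x) := by
  constructor
  simp [empiricalMeasure, ENNReal.inv_mul_cancel, hn]

theorem integral_empiricalMeasure {X : Type*} [MetricSpace X] [MeasurableSpace X] [BorelSpace X]
    (f : X → X) (n : ℕ) (x : X) {φ : X → ℝ} (hφ : Continuous φ) :
    ∫ y, φ y ∂(empiricalMeasure f n x) = birkhoffAverage ℝ f φ n x := by
  have hm : StronglyMeasurable φ := hφ.measurable.stronglyMeasurable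
  rw [empiricalMeasure, integral_smul_measure, integral_finsetSum_measure]
  · simp [birkhoffAverage, birkhoffSum, integral_dirac' _ _ hm]
  · intro i _
    exact integrable_dirac' hm (by simp [enorm_lt_top])

/-- Weak limits of empirical measures along orbit segments of growing length are invariant, since
the Birkhoff averages over a segment of length `n` of `φ ∘ f` and of `φ` differ by at most
`2 ‖φ‖ / n`. -/
theorem measurePreserving_of_tendsto_empiricalMeasure {X : Type*} [MetricSpace X]
    [MeasurableSpace X] [BorelSpace X] {f : X → X} (hf : Continuous f) {ι : Type*} {l : Filter ι}
    [l.NeBot] {n : ι → ℕ} (hn : Tendsto n l atTop) {x : ι → X} {ν : ι → ProbabilityMeasure X}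
    (hν : ∀ i, (ν i : Measure X) = empiricalMeasure f (n i) (x i)) {μ : ProbabilityMeasure X}
    (hμ : Tendsto ν l (𝓝 μ)) : MeasurePreserving f (μ : Measure X) μ := by
  refine ⟨hf.measurable, ?_⟩
  have : IsProbabilityMeasure (Measure.map f (μ : Measure X)) :=
    Measure.isProbabilityMeasure_map hf.measurable.aemeasurable
  refine ext_of_forall_integral_eq_of_IsFiniteMeasure fun φ => ?_
  rw [integral_map hf.measurable.aemeasurable φ.continuous.aestronglyMeasurable]
  have h := ProbabilityMeasure.tendsto_iff_forall_integral_tendsto.1 hμ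
  have h₁ := h (φ.compContinuous ⟨f, hf⟩)
  have h₂ := h φ
  have h₃ := h₁.sub h₂
  have hdiff : Tendsto (fun i => birkhoffAverage ℝ f φ (n i) (f (x i)) -
      birkhoffAverage ℝ f φ (n i) (x i)) l (𝓝 0) := by
    have : Tendsto (fun i => (2 * ‖φ‖) / (n i : ℝ)) l (𝓝 0) :=
      tendsto_const_nhds.div_atTop (tendsto_natCast_atTop_atTop.comp hn)
    refine squeeze_zero_norm (fun i => ?_) this
    rw [← dist_eq_norm, dist_birkhoffAverage_apply_birkhoffAverage]
    gcongr
    exact φ.dist_le_two_norm _ _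
  have hcomp : ∀ i, ∫ y, (φ.compContinuous ⟨f, hf⟩) y ∂(ν i : Measure X) =
      birkhoffAverage ℝ f φ (n i) (f (x i)) := by
    intro i
    rw [hν, integral_empiricalMeasure _ _ _ (φ.compContinuous ⟨f, hf⟩).continuous]
    simp only [birkhoffAverage, birkhoffSum, BoundedContinuousFunction.compContinuous_apply,
      ContinuousMap.coe_mk]
    simp only [← Function.iterate_succ_apply', Function.iterate_succ_apply]
  simp only [hcomp] at h₃
  simp only [hν, integral_empiricalMeasure _ _ _ φ.continuous] at h₃
  exact sub_eq_zero.1 (tendsto_nhds_unique h₃ hdiff)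

/-- The support of an invariant probability measure is measure saturated. -/
theorem support_subset_measureCenter {X : Type*} [MetricSpace X] [MeasurableSpace X] {f : X → X}
    {μ : Measure X} [hμ : IsProbabilityMeasure μ] (hinv : MeasurePreserving f μ μ) :
    μ.support ⊆ measureCenter f := by
  refine (isGreatest_measureCenter f).2 ?_
  rintro U hU ⟨x, hxU, hx⟩
  exact ⟨μ, hμ, hinv, (Measure.mem_support_iff_forall x).1 hx U (hU.mem_nhds hxU)⟩

open scoped Classical in
/-- Orbits spend almost all of their time near the measure center, uniformly in the starting
point: otherwise a weak limit of empirical measures would be an invariant probability measure that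
charges the complement of `U`. -/
theorem exists_forall_count_notMem_le {X : Type*} [MetricSpace X] [CompactSpace X]
    [MeasurableSpace X] [BorelSpace X] {f : X → X} (hf : Continuous f) {U : Set X}
    (hU : IsOpen U) (hYU : measureCenter f ⊆ U) {η : ℝ} (hη : 0 < η) :
    ∃ N : ℕ, ∀ n ≥ N, ∀ x, (Nat.count (fun i => f^[i] x ∉ U) n : ℝ) ≤ η * n := by
  by_contra! H
  choose n hn x hx using H
  have hn0 : ∀ N, n N ≠ 0 := by
    intro N h0
    have := hx N
    simp [h0] at this
  have htend : Tendsto n atTop atTop := tendsto_atTop_mono hn tendsto_id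
  let ν : ℕ → ProbabilityMeasure X := fun N =>
    ⟨empiricalMeasure f (n N) (x N), isProbabilityMeasure_empiricalMeasure f (hn0 N) (x N)⟩
  obtain ⟨μ, -, hμ⟩ := isCompact_univ.ultrafilter_le_nhds ((hyperfilter ℕ).map ν) (by simp)
  have hμ' : Tendsto ν (hyperfilter ℕ : Filter ℕ) (𝓝 μ) := hμ
  have hinv : MeasurePreserving f (μ : Measure X) μ :=
    measurePreserving_of_tendsto_empiricalMeasure hf
      (htend.mono_left Nat.hyperfilter_le_atTop) (fun N => rfl) hμ'
  have hnull : (μ : Measure X) Uᶜ = 0 := by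
    refine measure_mono_null (compl_subset_compl.2 ?_) 
      (Measure.measure_compl_support (μ := (μ : Measure X)))
    exact (support_subset_measureCenter hinv).trans hYU
  have hlim := ProbabilityMeasure.limsup_measure_closed_le_of_tendsto hμ' hU.isClosed_compl
  rw [hnull] at hlim
  have hge : ∀ N, ENNReal.ofReal η ≤ (ν N : Measure X) Uᶜ := by
    intro N
    change _ ≤ empiricalMeasure f (n N) (x N) Uᶜ
    rw [empiricalMeasure_apply _ _ _ hU.measurableSet.compl, mul_comm, ← div_eq_mul_inv,
      ENNReal.le_div_iff_mul_le (by simp [hn0]) (by simp)]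
    rw [← ENNReal.ofReal_natCast, ← ENNReal.ofReal_natCast, ← ENNReal.ofReal_mul hη.le]
    refine ENNReal.ofReal_le_ofReal ((hx N).le.trans_eq ?_)
    congr!
  have hle : ENNReal.ofReal η ≤ 0 :=
    (le_limsup_of_frequently_le (Eventually.of_forall hge).frequently).trans hlim
  exact absurd hle (by simpa using hη)

theorem measureCenter_nonempty {X : Type*} [MetricSpace X] [CompactSpace X] [MeasurableSpace X]
    [BorelSpace X] {f : X → X} (hf : Continuous f) [Nonempty X] : (measureCenter f).Nonempty := by
  classical
  by_contra! h
  obtain ⟨N, hN⟩ := exists_forall_count_notMem_le hf isOpen_empty h.subset (half_pos one_pos)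
  have := hN (N + 1) (Nat.le_succ N) (Classical.arbitrary X)
  simp at this
  linarith [(N.cast_nonneg : (0 : ℝ) ≤ N)]

/-- Minimal sets lie in the measure center: orbits in a minimal set `M` come arbitrarily close to
the measure center, so that `M` meets it, and the intersection is closed and invariant. -/
theorem minimalPoints_subset_measureCenter {X : Type*} [MetricSpace X] [CompactSpace X]
    [MeasurableSpace X] [BorelSpace X] {f : X → X} (hf : Continuous f) :
    minimalPoints f ⊆ measureCenter f := by
  classical
  rintro x ⟨M, hM, hx⟩
  have hclosed : IsClosed M := hM.prop.1
  have hmaps : MapsTo f M M := hM.prop.2.2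
  have hne : (M ∩ measureCenter f).Nonempty := by
    by_contra! h
    obtain ⟨N, hN⟩ := exists_forall_count_notMem_le hf hclosed.isOpen_compl
      (fun y hy hyM => h.subset ⟨hyM, hy⟩) (half_pos one_pos)
    have := hN (N + 1) (Nat.le_succ N) x
    have hall : ∀ i, f^[i] x ∈ M := fun i => hmaps.iterate i hx
    simp [hall] at this
    linarith [(N.cast_nonneg : (0 : ℝ) ≤ N)]
  have hsub : M ⊆ M ∩ measureCenter f :=
    hM.le_of_le ⟨hclosed.inter (isClosed_measureCenter f), hne,
      hmaps.inter_inter (mapsTo_measureCenter hf)⟩ inter_subset_left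
  exact (hsub hx).2

/-! ### Tracing lists of orbit segments -/

/-- The orbit of `z` visits, one after the other, the sets of the list `l`: an entry `(n, S)`
says that the current point lies in `S` and that the next entry is read `n` steps later. -/
def Visits {X : Type*} (f : X → X) : List (ℕ × Set X) → X → Prop
  | [], _ => True
  | s :: l, z => z ∈ s.2 ∧ Visits f l (f^[s.1] z)

/-- The total length of a list of visits. -/
def visitLength {X : Type*} (l : List (ℕ × Set X)) : ℕ := (l.map Prod.fst).sum

theorem visits_append {X : Type*} {f : X → X} {l₁ l₂ : List (ℕ × Set X)} {z : X} :
    Visits f (l₁ ++ l₂) z ↔ Visits f l₁ z ∧ Visits f l₂ (f^[visitLength l₁] z) := by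
  induction l₁ generalizing z with
  | nil => simp [Visits, visitLength]
  | cons s l ih =>
    simp only [List.cons_append, Visits, ih, and_assoc, visitLength, List.map_cons, List.sum_cons,
      ← Function.iterate_add_apply, add_comm s.1]

theorem visits_flatten_replicate {X : Type*} {f : X → X} {l : List (ℕ × Set X)} {R : ℕ} {z : X} :
    Visits f (List.replicate R l).flatten z ↔ ∀ r < R, Visits f l (f^[r * visitLength l] z) := by
  induction R generalizing z with
  | zero => simp [Visits]
  | succ R ih =>
    rw [List.replicate_succ, List.flatten_cons, visits_append, ih, Nat.forall_lt_succ_left']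
    simp [← Function.iterate_add_apply, add_mul]

theorem visits_flatten_map {X α : Type*} {f : X → X} (F : α → List (ℕ × Set X)) (len : α → ℕ)
    {l : List α} (hF : ∀ a ∈ l, visitLength (F a) = len a) {z : X} :
    Visits f (l.map F).flatten z ↔ Visits f (l.map fun a => (len a, {w | Visits f (F a) w})) z := by
  induction l generalizing z with
  | nil => simp [Visits]
  | cons a l ih =>
    simp [Visits, visits_append, ih fun b hb => hF b (by simp [hb]), hF a (by simp)]

theorem Visits.mono {X α : Type*} {f : X → X} {len : α → ℕ} {S T : α → Set X} {l : List α}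
    (hST : ∀ a ∈ l, S a ⊆ T a) {z : X} (h : Visits f (l.map fun a => (len a, S a)) z) :
    Visits f (l.map fun a => (len a, T a)) z := by
  induction l generalizing z with
  | nil => trivial
  | cons a l ih =>
    exact ⟨hST a (by simp) h.1, ih (fun b hb => hST b (by simp [hb])) h.2⟩

theorem isClosed_setOf_visits {X : Type*} [TopologicalSpace X] {f : X → X} (hf : Continuous f)
    {l : List (ℕ × Set X)} (hl : ∀ s ∈ l, IsClosed s.2) : IsClosed {z | Visits f l z} := by
  induction l with
  | nil => simp [Visits]
  | cons s l ih =>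
    exact (hl s (by simp)).inter
      ((ih fun t ht => hl t (by simp [ht])).preimage (hf.iterate s.1))

theorem visits_ofFn {X : Type*} {f : X → X} {m : ℕ} {n : Fin m → ℕ} {S : Fin m → Set X} {z : X} :
    Visits f (List.ofFn fun j => (n j, S j)) z ↔
      ∀ j : Fin m, f^[∑ s ∈ Finset.Iio j, n s] z ∈ S j := by
  induction m generalizing z with
  | zero => simp [Visits]
  | succ m ih =>
    have h0 : Finset.Iio (0 : Fin (m + 1)) = ∅ := by ext; simp
    have hs : ∀ j : Fin m, ∑ s ∈ Finset.Iio j.succ, n s =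
        (∑ s ∈ Finset.Iio j, n s.succ) + n 0 := by
      intro j
      have : Finset.Iio j.succ = insert 0 ((Finset.Iio j).map (Fin.succEmb m)) := by
        ext i
        refine Fin.cases ?_ (fun i => ?_) i <;> simp [Fin.succ_pos]
      rw [this, Finset.sum_insert (by simp), Finset.sum_map, add_comm]
      rfl
    rw [List.ofFn_succ, Visits, ih, Fin.forall_fin_succ]
    simp [h0, hs, Function.iterate_add_apply]

open scoped Classical in
theorem mem_mistakeBowenBall_iff {X : Type*} [MetricSpace X] {f : X → X} {g : MistakeFunction}
    {n : ℕ} {x y : X} {ε : ℝ} :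
    y ∈ mistakeBowenBall f g n x ε ↔
      Nat.count (fun i => ε ≤ dist (f^[i] x) (f^[i] y)) n ≤ g.val n ε := by
  have hcard := Finset.card_filter_add_card_filter_not (s := Finset.range n)
    (fun i => ε ≤ dist (f^[i] x) (f^[i] y))
  rw [Finset.card_range, ← Nat.count_eq_card_filter_range] at hcard
  simp only [mistakeBowenBall, almostFullSubsets, bowenBallAlong, mem_iUnion, mem_ofPred_eq,
    exists_prop]
  constructor
  · rintro ⟨A, ⟨hA, hn⟩, hy⟩
    have : A.card ≤ _ := Finset.card_le_card (s := A) (t := {i ∈ Finset.range n |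
      ¬ ε ≤ dist (f^[i] x) (f^[i] y)}) fun i hi => by simpa using ⟨by simpa using hA hi, hy i hi⟩
    omega
  · intro h
    refine ⟨{i ∈ Finset.range n | ¬ ε ≤ dist (f^[i] x) (f^[i] y)},
      ⟨Finset.filter_subset _ _, by omega⟩, fun i hi => ?_⟩
    simpa using (Finset.mem_filter.1 hi).2

open scoped Classical in
theorem isClosed_setOf_count_lt_dist_le {X : Type*} [MetricSpace X] {f : X → X}
    (hf : Continuous f) (n : ℕ) (x : X) (ε : ℝ) (c : ℕ) :
    IsClosed {y | Nat.count (fun i => ε < dist (f^[i] x) (f^[i] y)) n ≤ c} := by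
  rw [← isOpen_compl_iff, isOpen_iff_mem_nhds]
  intro y hy
  have : ∀ᶠ w in 𝓝 y, ∀ i ∈ Finset.range n, ε < dist (f^[i] x) (f^[i] y) →
      ε < dist (f^[i] x) (f^[i] w) := by
    refine (Filter.eventually_all_finset _).2 fun i _ => ?_
    by_cases h : ε < dist (f^[i] x) (f^[i] y)
    · have hc : Continuous fun w => dist (f^[i] x) (f^[i] w) :=
        continuous_const.dist (hf.iterate i)
      exact (hc.continuousAt.eventually_const_lt h).mono fun w hw _ => hw
    · exact Eventually.of_forall fun w h' => absurd h' h
  filter_upwards [this] with w hw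
  simp only [mem_compl_iff, mem_ofPred_eq, not_le] at hy ⊢
  exact hy.trans_le (Nat.count_mono_left fun i hi => hw i (Finset.mem_range.2 hi))

/-- Almost specification in terms of lists of orbit segments `(ε, x, n)`. -/
theorem tracesIn_iff_forall_list {X : Type*} [MetricSpace X] {f : X → X} {g : MistakeFunction}
    {k : ℝ → ℕ} {Z : Set X} :
    TracesIn f g k Z ↔ (∀ ε : ℝ, 0 < ε → 0 < k ε ∧ ∀ n : ℕ, k ε ≤ n → g.val n ε < n) ∧
      ∀ l : List (ℝ × X × ℕ), l ≠ [] → (∀ s ∈ l, 0 < s.1 ∧ k s.1 ≤ s.2.2) →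
        ∃ z ∈ Z, Visits f (l.map fun s => (s.2.2, mistakeBowenBall f g s.2.2 s.2.1 s.1)) z := by
  refine and_congr_right fun _ => ⟨fun h l hl hs => ?_, fun h m hm ε x n hε hn => ?_⟩
  · obtain ⟨z, hz, hv⟩ := h l.length (List.length_pos_iff.2 hl) (fun j => (l.get j).1)
      (fun j => (l.get j).2.1) (fun j => (l.get j).2.2) (fun j => (hs _ (l.get_mem j)).1)
      (fun j => (hs _ (l.get_mem j)).2)
    refine ⟨z, hz, ?_⟩
    rw [← List.ofFn_get l, List.map_ofFn]
    exact visits_ofFn.2 hv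
  · obtain ⟨z, hz, hv⟩ := h (List.ofFn fun j => (ε j, x j, n j))
      (by simpa using Nat.one_le_iff_ne_zero.1 hm)
      (by simpa [List.mem_ofFn] using fun j => ⟨hε j, hn j⟩)
    rw [List.map_ofFn] at hv
    exact ⟨z, hz, visits_ofFn.1 hv⟩

/-! ### Tracing by minimal points -/

theorem exists_isMinimalSet_subset {X : Type*} [MetricSpace X] [CompactSpace X] (f : X → X)
    {A : Set X} (hA : IsClosed A) (hne : A.Nonempty) (hf : MapsTo f A A) :
    ∃ M ⊆ A, IsMinimalSet f M := by
  refine zorn_superset_nonempty {B : Set X | IsClosed B ∧ B.Nonempty ∧ MapsTo f B B}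
    (fun c hc hchain hcne => ⟨⋂₀ c, ⟨?_, ?_, ?_⟩, fun s hs => sInter_subset_of_mem hs⟩) A
    ⟨hA, hne, hf⟩
  · exact isClosed_sInter fun s hs => (hc hs).1
  · have : Nonempty c := hcne.to_subtype
    exact IsCompact.nonempty_sInter_of_directed_nonempty_isCompact_isClosed
      (fun s hs t ht => (hchain.total hs ht).elim (fun h => ⟨s, hs, subset_rfl, h⟩)
        fun h => ⟨t, ht, h, subset_rfl⟩) (fun s hs => (hc hs).2.1) (fun s hs => (hc hs).1.isCompact)
      fun s hs => (hc hs).1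
  · exact fun x hx s hs => (hc hs).2.2 (hx s hs)

/-- A minimal set `M` of `f^P` consists of minimal points of `f`: the union of
`M, f(M), …, f^{P-1}(M)` is a minimal set of `f`. -/
theorem IsMinimalSet.subset_minimalPoints_of_iterate {X : Type*} [MetricSpace X] [CompactSpace X]
    {f : X → X} (hf : Continuous f) {P : ℕ} (hP : 0 < P) {M : Set X}
    (hM : IsMinimalSet f^[P] M) : M ⊆ minimalPoints f := by
  have hMc : IsClosed M := hM.prop.1
  have hMm : MapsTo f^[P] M M := hM.prop.2.2
  have hsub : M ⊆ ⋃ i ∈ Finset.range P, f^[i] '' M := fun x hx =>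
    mem_iUnion₂.2 ⟨0, Finset.mem_range.2 hP, x, hx, rfl⟩
  refine fun x hx => ⟨⋃ i ∈ Finset.range P, f^[i] '' M, ⟨⟨?_, ⟨x, hsub hx⟩, ?_⟩, ?_⟩, hsub hx⟩
  · exact isClosed_biUnion_finset fun i _ => (hMc.isCompact.image (hf.iterate i)).isClosed
  · intro y hy
    obtain ⟨i, hi, w, hw, rfl⟩ := mem_iUnion₂.1 hy
    rw [← Function.iterate_succ_apply' f]
    rcases (Nat.succ_le_of_lt (Finset.mem_range.1 hi)).lt_or_eq with h | h
    · exact mem_iUnion₂.2 ⟨i + 1, Finset.mem_range.2 h, w, hw, rfl⟩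
    · rw [h]
      exact hsub (hMm hw)
  · rintro A ⟨hAc, ⟨y, hy⟩, hAm⟩ hAsub
    obtain ⟨i, hi, w, hw, rfl⟩ := mem_iUnion₂.1 (hAsub hy)
    have hmem : f^[P] w ∈ A := by
      have := hAm.iterate (P - i) hy
      rwa [← Function.iterate_add_apply, Nat.sub_add_cancel (Finset.mem_range.1 hi).le] at this
    have hMA : M ⊆ M ∩ A :=
      hM.le_of_le ⟨hMc.inter hAc, ⟨_, hMm hw, hmem⟩, hMm.inter_inter (hAm.iterate P)⟩
        inter_subset_left
    refine iUnion₂_subset fun j _ => ?_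
    rintro _ ⟨v, hv, rfl⟩
    exact hAm.iterate j (hMA hv).2

/-- If a list of closed sets can be visited periodically arbitrarily many times, then it can be
visited by a minimal point: by compactness there is a closed nonempty set, invariant under the
power of `f` given by the period, all of whose points visit the list. -/
theorem exists_mem_minimalPoints_visits {X : Type*} [MetricSpace X] [CompactSpace X] {f : X → X}
    (hf : Continuous f) {l : List (ℕ × Set X)} (hl : ∀ s ∈ l, IsClosed s.2)
    (hpos : 0 < visitLength l) (h : ∀ R, ∃ z, Visits f (List.replicate R l).flatten z) :
    ∃ z ∈ minimalPoints f, Visits f l z := by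
  let K : ℕ → Set X := fun R => {z | Visits f (List.replicate R l).flatten z}
  have hK : ∀ R z, z ∈ K R ↔ ∀ r < R, Visits f l (f^[r * visitLength l] z) := fun R z =>
    visits_flatten_replicate
  have hKc : ∀ R, IsClosed (K R) := fun R => isClosed_setOf_visits hf fun s hs => by
    obtain ⟨l', hl', hs⟩ := List.mem_flatten.1 hs
    exact hl s (List.eq_of_mem_replicate hl' ▸ hs)
  have hne : (⋂ R, K R).Nonempty :=
    IsCompact.nonempty_iInter_of_sequence_nonempty_isCompact_isClosed K
      (fun R z hz => (hK R z).2 fun r hr => (hK (R + 1) z).1 hz r (hr.trans (Nat.lt_succ_self R)))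
      h (hKc 0).isCompact hKc
  have hmaps : MapsTo f^[visitLength l] (⋂ R, K R) (⋂ R, K R) := by
    intro z hz
    refine mem_iInter.2 fun R => (hK R _).2 fun r hr => ?_
    have := (hK (R + 1) z).1 (mem_iInter.1 hz (R + 1)) (r + 1) (by omega)
    rwa [add_mul, one_mul, Function.iterate_add_apply] at this
  obtain ⟨M, hMK, hM⟩ := exists_isMinimalSet_subset _ (isClosed_iInter hKc) hne hmaps
  obtain ⟨z, hz⟩ := hM.prop.2.1
  refine ⟨z, hM.subset_minimalPoints_of_iterate hf hpos hz, ?_⟩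
  simpa using (hK 1 z).1 (mem_iInter.1 (hMK hz) 1) 0 one_pos

/-- The mistake function `(n, ε) ↦ g(n, ε / 2)`. -/
noncomputable def MistakeFunction.halfScale (g : MistakeFunction) : MistakeFunction where
  ε₀ := 2 * g.ε₀
  ε₀_pos := by linarith [g.ε₀_pos]
  toFun n ε := g.toFun n (ε / 2)
  pos n ε h h' := g.pos n _ (by linarith) (by linarith)
  mono n ε h h' := g.mono n _ (by linarith) (by linarith)
  tendsto ε h h' := g.tendsto _ (by linarith) (by linarith)

theorem MistakeFunction.halfScale_val (g : MistakeFunction) (n : ℕ) (ε : ℝ) :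
    g.halfScale.val n ε = g.val n (ε / 2) := by
  simp only [MistakeFunction.val, MistakeFunction.halfScale]
  congr 1
  rw [← min_div_div_right (by norm_num : (0 : ℝ) ≤ 2) ε (2 * g.ε₀)]
  congr 1
  ring

/-- Passing to half the scale leaves room for replacing open Bowen balls by closed ones, so that
tracing points of longer and longer periodic repetitions can be passed to the limit. -/
theorem TracesIn.halfScale_minimalPoints {X : Type*} [MetricSpace X] [CompactSpace X] {f : X → X}
    (hf : Continuous f) {g : MistakeFunction} {k : ℝ → ℕ} (h : TracesIn f g k univ) :
    TracesIn f g.halfScale (fun ε => k (ε / 2)) (minimalPoints f) := by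
  classical
  rw [tracesIn_iff_forall_list] at h ⊢
  obtain ⟨hk, h⟩ := h
  refine ⟨fun ε hε => ?_, fun l hl hs => ?_⟩
  · simpa only [MistakeFunction.halfScale_val] using hk (ε / 2) (half_pos hε)
  let C : ℝ × X × ℕ → Set X := fun s =>
    {y | Nat.count (fun i => s.1 / 2 < dist (f^[i] s.2.1) (f^[i] y)) s.2.2 ≤ g.val s.2.2 (s.1 / 2)}
  obtain ⟨z, hz, hv⟩ : ∃ z ∈ minimalPoints f, Visits f (l.map fun s => (s.2.2, C s)) z := by
    refine exists_mem_minimalPoints_visits hf ?_ ?_ fun R => ?_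
    · simp only [List.mem_map]
      rintro _ ⟨s, -, rfl⟩
      exact isClosed_setOf_count_lt_dist_le hf _ _ _ _
    · obtain ⟨s, l, rfl⟩ := List.exists_cons_of_ne_nil hl
      have := hs s (by simp)
      have := (hk (s.1 / 2) (half_pos this.1)).1.trans_le this.2
      simp only [visitLength, List.map_cons, List.sum_cons]
      omega
    -- Almost specification applies to nonempty lists only, hence `R + 1` repetitions.
    · obtain ⟨z, -, hz⟩ := h (((List.replicate (R + 1) l).flatten).map fun s =>
          (s.1 / 2, s.2.1, s.2.2)) (by simp [hl, List.replicate_succ]) (by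
        simp only [List.mem_map]
        rintro _ ⟨s, hs', rfl⟩
        obtain ⟨l', hl', hs'⟩ := List.mem_flatten.1 hs'
        have := hs s (List.eq_of_mem_replicate hl' ▸ hs')
        exact ⟨half_pos this.1, this.2⟩)
      rw [List.map_map] at hz
      have hz' := Visits.mono (f := f) (len := fun s : ℝ × X × ℕ => s.2.2)
        (S := fun s => mistakeBowenBall f g s.2.2 s.2.1 (s.1 / 2)) (T := C)
        (fun s _ y hy => (Nat.count_mono_left fun i _ hi => le_of_lt hi).trans
          (mem_mistakeBowenBall_iff.1 hy)) hz
      rw [List.map_flatten, List.map_replicate, visits_flatten_replicate] at hz'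
      exact ⟨z, visits_flatten_replicate.2 fun r hr => hz' r (by omega)⟩
  refine ⟨z, hz, Visits.mono (fun s hs' y hy => ?_) hv⟩
  rw [mem_mistakeBowenBall_iff, MistakeFunction.halfScale_val]
  have := (hs s hs').1
  exact (Nat.count_mono_left fun i _ hi => (half_lt_self this).trans_le hi).trans hy

/-! ### Restriction to an invariant set -/

theorem mem_mistakeBowenBall_restrict_iff {X : Type*} [MetricSpace X] {f : X → X} {Y : Set X}
    (h : MapsTo f Y Y) {g : MistakeFunction} {n : ℕ} {x y : Y} {ε : ℝ} :
    y ∈ mistakeBowenBall (h.restrict f Y Y) g n x ε ↔ (y : X) ∈ mistakeBowenBall f g n x ε := by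
  have hit : ∀ (i : ℕ) (z : Y), (((h.restrict f Y Y)^[i] z : Y) : X) = f^[i] z := fun i z => by
    rw [h.iterate_restrict, MapsTo.val_restrict_apply]
  simp only [mem_mistakeBowenBall_iff, Subtype.dist_eq, hit]

theorem visits_restrict_iff {X : Type*} [MetricSpace X] {f : X → X} {Y : Set X}
    (h : MapsTo f Y Y) {g : MistakeFunction} {l : List (ℝ × Y × ℕ)} {z : Y} :
    Visits (h.restrict f Y Y)
        (l.map fun s => (s.2.2, mistakeBowenBall (h.restrict f Y Y) g s.2.2 s.2.1 s.1)) z ↔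
      Visits f (l.map fun s => (s.2.2, mistakeBowenBall f g s.2.2 (s.2.1 : X) s.1)) z := by
  induction l generalizing z with
  | nil => simp [Visits]
  | cons s l ih =>
    simp only [List.map_cons, Visits, ih, mem_mistakeBowenBall_restrict_iff]
    rw [h.iterate_restrict, MapsTo.val_restrict_apply]

theorem TracesIn.restrict {X : Type*} [MetricSpace X] {f : X → X} {Y Z : Set X}
    (h : MapsTo f Y Y) (hZ : Z ⊆ Y) {g : MistakeFunction} {k : ℝ → ℕ} (hT : TracesIn f g k Z) :
    TracesIn (h.restrict f Y Y) g k univ := by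
  rw [tracesIn_iff_forall_list] at hT ⊢
  refine ⟨hT.1, fun l hl hs => ?_⟩
  obtain ⟨z, hz, hv⟩ := hT.2 (l.map fun s => (s.1, (s.2.1 : X), s.2.2)) (by simpa using hl) (by
    simp only [List.mem_map]
    rintro _ ⟨s, hs', rfl⟩
    exact hs s hs')
  rw [List.map_map] at hv
  exact ⟨⟨z, hZ hz⟩, mem_univ _, (visits_restrict_iff h).2 hv⟩

/-! ### Mistake functions from sublinear bounds -/

theorem MistakeFunction.exists_forall_val_le (g : MistakeFunction) {ε η : ℝ} (hε : 0 < ε)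
    (hη : 0 < η) : ∃ N : ℕ, ∀ n ≥ N, (g.val n ε : ℝ) ≤ η * n := by
  have h := g.tendsto (min ε g.ε₀) (lt_min hε g.ε₀_pos) (min_le_right _ _)
  obtain ⟨N, hN⟩ := eventually_atTop.1 ((h.eventually_lt_const hη).and (eventually_gt_atTop 0))
  refine ⟨N, fun n hn => ?_⟩
  obtain ⟨h₁, h₂⟩ := hN n hn
  exact ((div_lt_iff₀ (by exact_mod_cast h₂)).1 h₁).le

/-- A function of sublinear growth in `n`, not necessarily monotone or positive, is dominated by a
mistake function with `ε₀ = 1`, namely one plus its running maximum. -/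
theorem exists_mistakeFunction_ge (c : ℕ → ℝ → ℕ)
    (hc : ∀ ε > 0, ∀ η : ℝ, 0 < η → ∃ N : ℕ, ∀ n ≥ N, (c n ε : ℝ) ≤ η * n) :
    ∃ g : MistakeFunction, ∀ n ε, c n (min ε 1) ≤ g.val n ε := by
  refine ⟨⟨1, one_pos, fun n ε => 1 + (Finset.range (n + 1)).sup fun i => c i ε,
    fun n ε _ _ => by omega, fun n ε _ _ => ?_, fun ε hε _ => ?_⟩, fun n ε => ?_⟩
  · exact Nat.add_le_add_left (Finset.sup_mono (Finset.range_mono (by omega))) 1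
  · rw [Metric.tendsto_atTop]
    intro η hη
    obtain ⟨N, hN⟩ := hc ε hε (η / 3) (by linarith)
    set C : ℕ := 1 + (Finset.range N).sup fun i => c i ε with hC
    obtain ⟨K, hK⟩ := exists_nat_gt (C / (η / 3))
    refine ⟨K + 1, fun n hn => ?_⟩
    have hKn : (K : ℝ) + 1 ≤ n := by exact_mod_cast hn
    have hn0 : (0 : ℝ) < n := by linarith [(K.cast_nonneg : (0 : ℝ) ≤ K)]
    have hCn : (C : ℝ) ≤ η / 3 * n := by
      have := (div_lt_iff₀ (by linarith)).1 hK
      nlinarith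
    have hsup : ((1 + (Finset.range (n + 1)).sup fun i => c i ε : ℕ) : ℝ) ≤ C + η / 3 * n := by
      obtain ⟨i, hi, hieq⟩ := Finset.exists_mem_eq_sup (Finset.range (n + 1)) (by simp)
        fun i => c i ε
      rw [hieq]
      have hin : (i : ℝ) ≤ n := by exact_mod_cast Finset.mem_range_succ_iff.1 hi
      rcases lt_or_ge i N with h | h
      · have : 1 + c i ε ≤ C :=
          Nat.add_le_add_left (Finset.le_sup (f := fun i => c i ε) (Finset.mem_range.2 h)) 1
        have : ((1 + c i ε : ℕ) : ℝ) ≤ C := by exact_mod_cast this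
        nlinarith
      · have h1 : (1 : ℝ) ≤ C := by exact_mod_cast Nat.le_add_right 1 _
        have := hN i h
        push_cast
        nlinarith
    rw [Real.dist_eq, sub_zero, abs_of_nonneg (by positivity), div_lt_iff₀ hn0]
    nlinarith
  · exact (Finset.le_sup (f := fun i => c i (min ε 1)) (Finset.self_mem_range_succ n)).trans
      (Nat.le_add_left _ _)

/-! ### From the measure center to the whole space -/

open scoped Classical in
/-- Every orbit segment of length `n` can be cut into blocks, each assigned a starting point in
`Y`, such that any point tracing the blocks up to `ε / 2`, with mistakes allowed by `g`, traces
the segment up to `ε` with at most `c` mistakes. -/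
def BlockTraceable {X : Type*} [MetricSpace X] (f : X → X) (g : MistakeFunction) (k : ℝ → ℕ)
    (Y : Set X) (ε : ℝ) (n c : ℕ) : Prop :=
  ∀ x : X, ∃ b : List (Y × ℕ), b ≠ [] ∧ (∀ t ∈ b, k (ε / 2) ≤ t.2) ∧ (b.map Prod.snd).sum = n ∧
    ∀ w, Visits f (b.map fun t => (t.2, mistakeBowenBall f g t.2 (t.1 : X) (ε / 2))) w →
      Nat.count (fun i => ε ≤ dist (f^[i] x) (f^[i] w)) n ≤ c

open scoped Classical in
/-- A block starting close to `Y` costs only the mistakes allowed by `g`; a block starting away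
from `Y` is given up altogether. -/
theorem exists_block_count_le {X : Type*} [MetricSpace X] {f : X → X} {g : MistakeFunction}
    {Y : Set X} (hY : Y.Nonempty) {ε η δ : ℝ} {L : ℕ}
    (hL : ∀ n ≥ L, (g.val n (ε / 2) : ℝ) ≤ η * n)
    (hδ : ∀ i < 2 * L, ∀ x y : X, dist x y < δ → dist (f^[i] x) (f^[i] y) < ε / 2)
    {n : ℕ} (hn : L ≤ n) (hn2 : n < 2 * L) (hη : 0 < η) (x : X) :
    ∃ y : Y, ∀ w ∈ mistakeBowenBall f g n (y : X) (ε / 2),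
      (Nat.count (fun i => ε ≤ dist (f^[i] x) (f^[i] w)) n : ℝ) ≤
        η * n + 2 * L * Nat.count (fun i => f^[i] x ∉ Metric.thickening δ Y) n := by
  have hn0 : 0 < n := by omega
  by_cases hx : x ∈ Metric.thickening δ Y
  · obtain ⟨y, hy, hxy⟩ := Metric.mem_thickening_iff.1 hx
    refine ⟨⟨y, hy⟩, fun w hw => ?_⟩
    rw [mem_mistakeBowenBall_iff] at hw
    have hle : Nat.count (fun i => ε ≤ dist (f^[i] x) (f^[i] w)) n ≤ g.val n (ε / 2) := by
      refine (Nat.count_mono_left fun i hi h => ?_).trans hw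
      have h₁ := hδ i (by omega) x y hxy
      have h₂ := dist_triangle (f^[i] x) (f^[i] y) (f^[i] w)
      change ε / 2 ≤ dist (f^[i] y) (f^[i] w)
      linarith
    have hle' : (Nat.count (fun i => ε ≤ dist (f^[i] x) (f^[i] w)) n : ℝ) ≤ η * n :=
      (Nat.cast_le.2 hle).trans (hL n hn)
    exact hle'.trans (le_add_of_nonneg_right (by positivity))
  · refine ⟨⟨hY.some, hY.some_mem⟩, fun w _ => ?_⟩
    have h1 : 1 ≤ Nat.count (fun i => f^[i] x ∉ Metric.thickening δ Y) n := by
      refine le_trans ?_ (Nat.count_monotone _ hn0)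
      simp [Nat.count_succ, hx]
    have h2 : Nat.count (fun i => ε ≤ dist (f^[i] x) (f^[i] w)) n ≤ 2 * L := by
      have := Nat.count_le (p := fun i => ε ≤ dist (f^[i] x) (f^[i] w)) (n := n)
      omega
    have h1' : (1 : ℝ) ≤ Nat.count (fun i => f^[i] x ∉ Metric.thickening δ Y) n := by
      exact_mod_cast h1
    have h2' : (Nat.count (fun i => ε ≤ dist (f^[i] x) (f^[i] w)) n : ℝ) ≤ 2 * L := by
      exact_mod_cast h2
    have h3 : (0 : ℝ) ≤ η * n := by positivity
    have h4 : (0 : ℝ) ≤ 2 * L := by positivity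
    nlinarith

open scoped Classical in
/-- Splitting off blocks of length `L` until fewer than `2 * L` steps remain, the costs of the blocks
add up. -/
theorem exists_blocks_count_le {X : Type*} [MetricSpace X] {f : X → X} {g : MistakeFunction}
    {Y : Set X} (hY : Y.Nonempty) {ε η δ : ℝ} {L : ℕ} (hL0 : 0 < L)
    (hL : ∀ n ≥ L, (g.val n (ε / 2) : ℝ) ≤ η * n)
    (hδ : ∀ i < 2 * L, ∀ x y : X, dist x y < δ → dist (f^[i] x) (f^[i] y) < ε / 2)
    (hη : 0 < η) (n : ℕ) (hn : L ≤ n) (x : X) :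
    ∃ b : List (Y × ℕ), b ≠ [] ∧ (∀ t ∈ b, L ≤ t.2) ∧ (b.map Prod.snd).sum = n ∧
      ∀ w, Visits f (b.map fun t => (t.2, mistakeBowenBall f g t.2 (t.1 : X) (ε / 2))) w →
        (Nat.count (fun i => ε ≤ dist (f^[i] x) (f^[i] w)) n : ℝ) ≤
          η * n + 2 * L * Nat.count (fun i => f^[i] x ∉ Metric.thickening δ Y) n := by
  induction n using Nat.strong_induction_on generalizing x with
  | _ n ih =>
  rcases lt_or_ge n (2 * L) with h | h
  · obtain ⟨y, hy⟩ := exists_block_count_le hY hL hδ hn h hη x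
    exact ⟨[(y, n)], by simp, by simpa using hn, by simp, fun w hw => hy w hw.1⟩
  · obtain ⟨y, hy⟩ := exists_block_count_le hY hL hδ le_rfl (by omega) hη x
    obtain ⟨m, rfl⟩ : ∃ m, n = L + m := ⟨n - L, by omega⟩
    obtain ⟨b, -, hbL, hsum, hb⟩ := ih m (by omega) (by omega) (f^[L] x)
    refine ⟨(y, L) :: b, by simp, ?_, by simp [hsum], ?_⟩
    · simpa using fun a ha s hs => hbL (⟨a, ha⟩, s) hs
    · rintro w ⟨hw₁, hw₂⟩
      have h₁ := hy w hw₁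
      have h₂ := hb _ hw₂
      simp only [← Function.iterate_add_apply, add_comm _ L] at h₂
      rw [Nat.count_add, Nat.count_add]
      push_cast
      linarith

theorem exists_forall_dist_iterate_lt {X : Type*} [MetricSpace X] [CompactSpace X] {f : X → X}
    (hf : Continuous f) {ε : ℝ} (hε : 0 < ε) (n : ℕ) :
    ∃ δ > 0, ∀ i < n, ∀ x y : X, dist x y < δ → dist (f^[i] x) (f^[i] y) < ε := by
  induction n with
  | zero => exact ⟨1, one_pos, fun i hi => absurd hi (Nat.not_lt_zero i)⟩
  | succ n ih =>
    obtain ⟨δ, hδ, h⟩ := ih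
    obtain ⟨δ', hδ', h'⟩ := Metric.uniformContinuous_iff.1
      (CompactSpace.uniformContinuous_of_continuous (hf.iterate n)) ε hε
    refine ⟨min δ δ', lt_min hδ hδ', fun i hi x y hxy => ?_⟩
    rcases Nat.lt_succ_iff_lt_or_eq.1 hi with hi | rfl
    · exact h i hi x y (hxy.trans_le (min_le_left _ _))
    · exact h' (hxy.trans_le (min_le_right _ _))

/-- Long orbit segments are traceable through blocks in the measure center with an arbitrarily
small proportion of mistakes. -/
theorem exists_forall_blockTraceable {X : Type*} [MetricSpace X] [CompactSpace X]
    [MeasurableSpace X] [BorelSpace X] [Nonempty X] {f : X → X} (hf : Continuous f)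
    (g : MistakeFunction) (k : ℝ → ℕ) {ε η : ℝ} (hε : 0 < ε) (hη : 0 < η) :
    ∃ N : ℕ, ∀ n ≥ N, BlockTraceable f g k (measureCenter f) ε n ⌊η * n⌋₊ := by
  classical
  obtain ⟨L₀, hL₀⟩ := g.exists_forall_val_le (half_pos hε) (half_pos hη)
  set L := max (max L₀ (k (ε / 2))) 1
  have hL : 0 < L := lt_of_lt_of_le one_pos (le_max_right _ _)
  have hLL₀ : L₀ ≤ L := (le_max_left _ _).trans (le_max_left _ _)
  have hLk : k (ε / 2) ≤ L := (le_max_right _ _).trans (le_max_left _ _)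
  obtain ⟨δ, hδ, hdist⟩ := exists_forall_dist_iterate_lt hf (half_pos hε) (2 * L)
  have hLpos : (0 : ℝ) < L := by exact_mod_cast hL
  -- Each visit outside the neighbourhood may spoil a block of length up to `2 * L`.
  obtain ⟨N, hN⟩ := exists_forall_count_notMem_le hf Metric.isOpen_thickening
    (Metric.self_subset_thickening hδ (measureCenter f)) (η := η / (4 * L)) (by positivity)
  refine ⟨max N L, fun n hn x => ?_⟩
  obtain ⟨b, hb0, hbL, hsum, hb⟩ := exists_blocks_count_le (measureCenter_nonempty hf) hL
    (fun n hn => hL₀ n (hLL₀.trans hn)) hdist (half_pos hη) n ((le_max_right _ _).trans hn) x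
  refine ⟨b, hb0, fun t ht => hLk.trans (hbL t ht), hsum, fun w hw => Nat.le_floor ?_⟩
  have h₁ := hb w hw
  have h₂ := hN n ((le_max_left _ _).trans hn) x
  have h₃ : 2 * (L : ℝ) * (η / (4 * L) * n) = η / 2 * n := by
    field_simp
    norm_num
  have h₄ := mul_le_mul_of_nonneg_left h₂ (by positivity : 0 ≤ 2 * (L : ℝ))
  linarith

theorem BlockTraceable.mono {X : Type*} [MetricSpace X] {f : X → X} {g : MistakeFunction}
    {k : ℝ → ℕ} {Y : Set X} {ε : ℝ} {n c c' : ℕ} (hcc : c ≤ c')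
    (h : BlockTraceable f g k Y ε n c) : BlockTraceable f g k Y ε n c' := fun x =>
  let ⟨b, h₁, h₂, h₃, h₄⟩ := h x
  ⟨b, h₁, h₂, h₃, fun w hw => (h₄ w hw).trans hcc⟩

theorem hasAlmostSpecification_of_restrict_measureCenter {X : Type*} [MetricSpace X]
    [CompactSpace X] [MeasurableSpace X] [BorelSpace X] [Nonempty X] {f : X → X}
    (hf : Continuous f) (h : HasAlmostSpecification
      (MapsTo.restrict f (measureCenter f) (measureCenter f) (mapsTo_measureCenter hf))) :
    HasAlmostSpecification f := by
  classical
  obtain ⟨g, k, h⟩ := h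
  rw [tracesIn_iff_forall_list] at h
  set Y := measureCenter f
  -- The least number of mistakes is sublinear in `n`.
  let c : ℕ → ℝ → ℕ := fun n ε => sInf {c | BlockTraceable f g k Y ε n c}
  obtain ⟨g', hg'⟩ := exists_mistakeFunction_ge c fun ε hε η hη => by
    obtain ⟨N, hN⟩ := exists_forall_blockTraceable hf g k hε hη
    exact ⟨N, fun n hn => (Nat.cast_le.2 (Nat.sInf_le (hN n hn))).trans
      (Nat.floor_le (by positivity))⟩
  -- Scales above `1` are traced at scale `1`, in line with the convention for `ε > ε₀`.
  have key : ∀ ε : ℝ, ∃ K : ℕ, 0 < ε → 0 < K ∧ ∀ n ≥ K, g'.val n ε < n ∧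
      BlockTraceable f g k Y (min ε 1) n (g'.val n ε) := by
    intro ε
    by_cases hε : 0 < ε
    · obtain ⟨N, hN⟩ := exists_forall_blockTraceable hf g k (lt_min hε one_pos) one_pos
      obtain ⟨N', hN'⟩ := g'.exists_forall_val_le hε (half_pos one_pos)
      refine ⟨max (max N N') 1, fun _ => ⟨by omega, fun n hn => ⟨?_, ?_⟩⟩⟩
      · have h₁ := hN' n (by omega)
        have h₂ : (1 : ℝ) ≤ n := by exact_mod_cast (le_max_right _ _).trans hn
        have : (g'.val n ε : ℝ) < n := by linarith
        exact_mod_cast this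
      · have hne : {c | BlockTraceable f g k Y (min ε 1) n c}.Nonempty := ⟨_, hN n (by omega)⟩
        exact BlockTraceable.mono (hg' n ε) (Nat.sInf_mem hne)
    · exact ⟨0, fun h => absurd h hε⟩
  choose k' hk' using key
  refine ⟨g', k', tracesIn_iff_forall_list.2
    ⟨fun ε hε => ⟨(hk' ε hε).1, fun n hn => ((hk' ε hε).2 n hn).1⟩, fun l hl hs => ?_⟩⟩
  have hblocks : ∀ s : ℝ × X × ℕ, ∃ b : List (Y × ℕ), s ∈ l → b ≠ [] ∧
      (∀ t ∈ b, k (min s.1 1 / 2) ≤ t.2) ∧ (b.map Prod.snd).sum = s.2.2 ∧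
      ∀ w, Visits f (b.map fun t => (t.2, mistakeBowenBall f g t.2 (t.1 : X) (min s.1 1 / 2))) w →
        Nat.count (fun i => min s.1 1 ≤ dist (f^[i] s.2.1) (f^[i] w)) s.2.2 ≤
          g'.val s.2.2 s.1 := by
    intro s
    by_cases hsl : s ∈ l
    · obtain ⟨b, hb⟩ := ((hk' s.1 (hs s hsl).1).2 _ (hs s hsl).2).2 s.2.1
      exact ⟨b, fun _ => hb⟩
    · exact ⟨[], fun h => absurd h hsl⟩
  choose b hb using hblocks
  obtain ⟨z, -, hz⟩ := h.2 (l.map fun s => (b s).map fun t => (min s.1 1 / 2, t.1, t.2)).flatten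
    (by
      obtain ⟨s, l, rfl⟩ := List.exists_cons_of_ne_nil hl
      simp [(hb s (by simp)).1])
    (by
      simp only [List.mem_flatten, List.mem_map]
      rintro _ ⟨_, ⟨s, hsl, rfl⟩, ht⟩
      obtain ⟨t, htb, rfl⟩ := List.mem_map.1 ht
      exact ⟨half_pos (lt_min (hs s hsl).1 one_pos), (hb s hsl).2.1 t htb⟩)
  rw [visits_restrict_iff, List.map_flatten, List.map_map,
    visits_flatten_map _ (fun s => s.2.2)] at hz
  · refine ⟨z, mem_univ _, Visits.mono (fun s hsl w hw => ?_) hz⟩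
    simp only [Function.comp_apply, List.map_map, mem_ofPred_eq] at hw
    rw [mem_mistakeBowenBall_iff]
    exact (Nat.count_mono_left fun i _ hi => (min_le_left _ _).trans hi).trans
      ((hb s hsl).2.2.2 w hw)
  · intro s hsl
    rw [← (hb s hsl).2.2.1]
    simp [visitLength, Function.comp_def]

/-! ### Equivalence and tracing by minimal points -/

theorem mainTheorem7 {X : Type*} [MetricSpace X] [CompactSpace X] [MeasurableSpace X]
    [BorelSpace X] (f : X → X) (hf : Continuous f) :
    (HasAlmostSpecification f ↔
      HasAlmostSpecification
        (MapsTo.restrict f (measureCenter f) (measureCenter f) (mapsTo_measureCenter hf))) ∧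
    (HasAlmostSpecification f →
      ∃ (g : MistakeFunction) (k : ℝ → ℕ), TracesIn f g k (minimalPoints f)) := by
  have hmin : HasAlmostSpecification f →
      ∃ (g : MistakeFunction) (k : ℝ → ℕ), TracesIn f g k (minimalPoints f) :=
    fun ⟨g, k, h⟩ => ⟨_, _, h.halfScale_minimalPoints hf⟩
  refine ⟨⟨fun h => ?_, fun h => ?_⟩, hmin⟩
  · obtain ⟨g, k, hT⟩ := hmin h
    exact ⟨g, k, hT.restrict _ (minimalPoints_subset_measureCenter hf)⟩
  · rcases isEmpty_or_nonempty X with hX | hX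
    · obtain ⟨g, k, hT⟩ := h
      exact ⟨g, k, hT.1, fun m hm ε x => hX.elim (x ⟨0, hm⟩)⟩
    · exact hasAlmostSpecification_of_restrict_measureCenter hf h
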